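/- Let $\mathbb{C}$ be a small category that is a regular Mal'tsev category. Let $\mathrm{Lex}(\mathbb{C},\mathrm{Set})$ be the category of finite-limit-preserving functors $\mathbb{C}\to\mathrm{Set}$ and natural transformations, and put $\widetilde{\mathbb{C}}=\mathrm{Lex}(\mathbb{C},\mathrm{Set})^{\mathrm{op}}$. Then $\widetilde{\mathbb{C}}$ is also a regular Mal'tsev category. Here a category is \emph{regular} if it has finite limits, every kernel pair has a coequaliser, and regular epimorphisms are stable under pullback. A category with finite limits is a \emph{Mal'tsev category} if every (internal) reflexive relation $R\rightarrowtail X\times X$ in it is an equivalence relation. A \emph{regular Mal'tsev category} is a category that is both regular and Mal'tsev. -/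

import Mathlib

open CategoryTheory CategoryTheory.Limits

universe v u

/-- A Mal'tsev category: a finitely complete category in which every internal reflexive relation
(a jointly monic pair `p₁, p₂ : R ⟶ X` with a common section, equivalently a monomorphism
`R ⟶ X ⨯ X` through which the diagonal factors) is an equivalence relation. -/
class IsMaltsevCategory (C : Type u) [Category.{v} C] : Prop extends HasFiniteLimits C where
  isEquivalenceRelation : ∀ {R X : C} (p₁ p₂ : R ⟶ X),
    ReflexiveRelation p₁ p₂ → IsEquivalenceRelation p₁ p₂

/-! `Lex(C, Set)ᵒᵖ` is the category of pro-objects of `C`, and both properties descend from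
categories of diagrams `Iᵒᵖ ⥤ C` with `I` filtered. There, images and difunctionality of relations
are obtained pointwise, and `proLim` preserves finite limits and sends pointwise regular epis to
regular epis. Parallel pairs and cospans of pro-objects lift to diagrams of one common shape. The
lift of a regular epi or of a relation need not be of the same kind, but its image factorisation
repairs this: `proLim` inverts the mono part in the first case and the epi part in the second.
Difunctionality replaces equivalence relations because a reflexivity section need not lift. -/

namespace CategoryTheory

open Opposite

/-- A span `p₁ : R ⟶ X`, `p₂ : R ⟶ Y`, thought of as a relation, is difunctional if `x R y`,
`x' R y` and `x' R y'` imply `x R y'`, in terms of generalized elements. -/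
def IsDifunctional {C : Type*} [Category* C] {R X Y : C} (p₁ : R ⟶ X) (p₂ : R ⟶ Y) : Prop :=
  ∀ ⦃T : C⦄ (a b c : T ⟶ R), a ≫ p₂ = b ≫ p₂ → b ≫ p₁ = c ≫ p₁ →
    ∃ d : T ⟶ R, d ≫ p₁ = a ≫ p₁ ∧ d ≫ p₂ = c ≫ p₂

/-! ### Difunctional relations -/

section Difunctional

variable {C : Type*} [Category* C]

lemma IsDifunctional.of_iso {R R' X X' Y Y' : C} {p₁ : R ⟶ X} {p₂ : R ⟶ Y}
    (h : IsDifunctional p₁ p₂) {q₁ : R' ⟶ X'} {q₂ : R' ⟶ Y'} (r : R' ≅ R) (x : X' ⟶ X)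
    (y : Y' ⟶ Y) [Mono x] [Mono y] (h₁ : q₁ ≫ x = r.hom ≫ p₁) (h₂ : q₂ ≫ y = r.hom ≫ p₂) :
    IsDifunctional q₁ q₂ := by
  intro T a b c hab hbc
  obtain ⟨d, hd₁, hd₂⟩ := h (a ≫ r.hom) (b ≫ r.hom) (c ≫ r.hom)
    (by simp [← h₂, reassoc_of% hab]) (by simp [← h₁, reassoc_of% hbc])
  refine ⟨d ≫ r.inv, ?_, ?_⟩
  · rw [← cancel_mono x]; simp [h₁, hd₁]
  · rw [← cancel_mono y]; simp [h₂, hd₂]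

/-- It suffices to have a witness for the universal triple, an iterated pullback, which `F`
preserves. -/
lemma IsDifunctional.map [HasPullbacks C] {D : Type*} [Category* D] (F : C ⥤ D)
    [PreservesLimitsOfShape WalkingCospan F] {R X Y : C} {p₁ : R ⟶ X} {p₂ : R ⟶ Y}
    (h : IsDifunctional p₁ p₂) : IsDifunctional (F.map p₁) (F.map p₂) := by
  obtain ⟨Q, a, b, H₁⟩ : ∃ (Q : C) (a b : Q ⟶ R), IsPullback a b p₂ p₂ :=
    ⟨_, _, _, .of_hasPullback p₂ p₂⟩
  obtain ⟨W, q, c, H₂⟩ : ∃ (W : C) (q : W ⟶ Q) (c : W ⟶ R), IsPullback q c (b ≫ p₁) p₁ :=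
    ⟨_, _, _, .of_hasPullback (b ≫ p₁) p₁⟩
  obtain ⟨d, hd₁, hd₂⟩ := h (q ≫ a) (q ≫ b) c (by simp [H₁.w]) (by simp [H₂.w])
  replace hd₁ := congr(F.map $hd₁)
  replace hd₂ := congr(F.map $hd₂)
  simp only [F.map_comp, Category.assoc] at hd₁ hd₂
  intro T x y z hxy hyz
  replace H₁ := H₁.map F
  replace H₂ := H₂.map F
  refine ⟨H₂.lift (H₁.lift x y hxy) z (by simp [hyz]) ≫ F.map d, ?_, ?_⟩
  · simp [hd₁]
  · simp [hd₂]

/-- Symmetry comes from `yRy, xRy, xRx`, and transitivity from `xRy, yRy, yRz`. -/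
lemma IsDifunctional.isEquivalenceRelation [HasPullbacks C] {R X : C} {p₁ p₂ : R ⟶ X}
    (h : IsDifunctional p₁ p₂) (e : ReflexiveRelation p₁ p₂) : IsEquivalenceRelation p₁ p₂ := by
  obtain ⟨s, hs₁, hs₂⟩ := h (p₂ ≫ e.r) (𝟙 R) (p₁ ≫ e.r) (by simp) (by simp)
  obtain ⟨t, ht₁, ht₂⟩ := h (pullback.fst p₂ p₁) (pullback.fst p₂ p₁ ≫ p₂ ≫ e.r)
    (pullback.snd p₂ p₁) (by simp) (by simp [pullback.condition])
  exact ⟨⟨{ e with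
    s := s
    symmetry₁ := by simp [hs₁]
    symmetry₂ := by simp [hs₂]
    c := _
    isLimit := pullbackIsPullback p₂ p₁
    t := t
    transitivity₁ := ht₁
    transitivity₂ := ht₂ }⟩⟩

/-- In a Mal'tsev category, every relation is difunctional. -/
lemma JointlyMono₂.isDifunctional [IsMaltsevCategory C] {R X Y : C} (p₁ : R ⟶ X) (p₂ : R ⟶ Y)
    [h : JointlyMono₂ p₁ p₂] : IsDifunctional p₁ p₂ := by
  obtain ⟨Q, u, w, H₁⟩ : ∃ (Q : C) (u w : Q ⟶ R), IsPullback u w p₁ p₁ :=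
    ⟨_, _, _, .of_hasPullback p₁ p₁⟩
  obtain ⟨W, q, v, H₂⟩ : ∃ (W : C) (q : W ⟶ Q) (v : W ⟶ R), IsPullback q v (w ≫ p₂) p₂ :=
    ⟨_, _, _, .of_hasPullback (w ≫ p₂) p₂⟩
  -- Relate `u` to `v` when some `w` agrees with `u` in `X` and with `v` in `Y`; such a `w` is
  -- unique. Here `c` is related to `a` through `b`, and the middle element for the symmetric pair
  -- is the required `d`.
  let e : ReflexiveRelation (q ≫ u) v :=
    { right_cancellation := fun T f g hf hg ↦ by
        simp only [← Category.assoc] at hf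
        refine H₂.hom_ext (H₁.hom_ext hf (h.right_cancellation _ _ ?_ ?_)) hg
        · simpa [H₁.w] using hf =≫ p₁
        · simpa [H₂.w] using hg =≫ p₂
      r := H₂.lift (H₁.lift (𝟙 _) (𝟙 _) rfl) (𝟙 _) (by simp)
      reflexivity₁ := by simp
      reflexivity₂ := by simp }
  obtain ⟨⟨E⟩⟩ := IsMaltsevCategory.isEquivalenceRelation (q ≫ u) v e
  intro T a b c hab hbc
  have h₁ := E.symmetry₁
  have h₂ := E.symmetry₂
  refine ⟨H₂.lift (H₁.lift c b hbc.symm) a (by simp [hab]) ≫ E.s ≫ q ≫ w, ?_, ?_⟩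
  · simp only [Category.assoc, ← H₁.w]
    simp [reassoc_of% h₁]
  · simp only [Category.assoc, H₂.w]
    simp [reassoc_of% h₂]

/-- A functor preserving limits maps jointly monic pairs to jointly monic pairs. -/
lemma JointlyMono₂.map [HasBinaryProducts C] [HasPullbacks C] {D : Type*} [Category* D] (F : C ⥤ D)
    [PreservesFiniteLimits F] {R X Y : C} (p₁ : R ⟶ X) (p₂ : R ⟶ Y)
    [h : JointlyMono₂ p₁ p₂] : JointlyMono₂ (F.map p₁) (F.map p₂) where
  right_cancellation T f g hf hg := by
    obtain ⟨l, hl₁, hl₂⟩ : ∃ l : R ⟶ X ⨯ Y, l ≫ prod.fst = p₁ ∧ l ≫ prod.snd = p₂ :=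
      ⟨prod.lift p₁ p₂, prod.lift_fst .., prod.lift_snd ..⟩
    have : Mono l := ⟨fun f g hfg ↦ h.right_cancellation _ _
      (by simp only [← hl₁, reassoc_of% hfg]) (by simp only [← hl₂, reassoc_of% hfg])⟩
    rw [← cancel_mono (F.map l)]
    refine BinaryFan.IsLimit.hom_ext (isLimitOfHasBinaryProductOfPreservesLimit F X Y) ?_ ?_
    · simpa [← hl₁] using hf
    · simpa [← hl₂] using hg

end Difunctional

/-! ### Pointwise structure on diagrams -/

section FunctorCategory

variable {J : Type*} [Category* J] {C : Type*} [Category* C]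

/-- Relations in a category of functors with values in a Mal'tsev category are difunctional. -/
lemma JointlyMono₂.isDifunctional_functor [IsMaltsevCategory C] {R X Y : J ⥤ C}
    (p₁ : R ⟶ X) (p₂ : R ⟶ Y) [JointlyMono₂ p₁ p₂] : IsDifunctional p₁ p₂ := by
  have h (j : J) : JointlyMono₂ (p₁.app j) (p₂.app j) :=
    JointlyMono₂.map ((evaluation J C).obj j) p₁ p₂
  intro T a b c hab hbc
  choose d hd₁ hd₂ using fun j ↦ JointlyMono₂.isDifunctional (p₁.app j) (p₂.app j)
    (a.app j) (b.app j) (c.app j) congr(($hab).app j) congr(($hbc).app j)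
  refine ⟨{ app := d, naturality := fun j k u ↦ ?_ }, by ext; simp [hd₁], by ext; simp [hd₂]⟩
  -- Pointwise witnesses are unique by joint monicity, hence natural.
  apply (h k).right_cancellation
  · simp [hd₁, reassoc_of% hd₁]
  · simp [hd₂, reassoc_of% hd₂]

variable (J C) in
/-- The natural transformations all of whose components are regular epimorphisms. -/
def pointwiseRegularEpi : MorphismProperty (J ⥤ C) := fun _ _ φ ↦ ∀ j, IsRegularEpi (φ.app j)

instance [Regular C] : (pointwiseRegularEpi J C).IsStableUnderBaseChange where
  of_isPullback sq hg j :=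
    Regular.regularEpiIsStableUnderBaseChange.of_isPullback
      (sq.map ((evaluation J C).obj j)) (hg j)

/-- Every natural transformation between functors with values in a regular category
factors as a pointwise regular epimorphism followed by a monomorphism. -/
lemma exists_pointwiseRegularEpi_mono_fac [Regular C] {A B : J ⥤ C} (φ : A ⟶ B) :
    ∃ (I : J ⥤ C) (e : A ⟶ I) (m : I ⟶ B), pointwiseRegularEpi J C e ∧ Mono m ∧ e ≫ m = φ := by
  let Φ : J ⥤ Arrow C :=
    { obj j := Arrow.mk (φ.app j)
      map u := Arrow.homMk (A.map u) (B.map u) (by simp) }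
  let e : A ⟶ Φ ⋙ im :=
    { app j := factorThruImage (φ.app j)
      naturality j k u := (image.factor_map (Φ.map u)).symm }
  let m : Φ ⋙ im ⟶ B :=
    { app j := image.ι (φ.app j)
      naturality j k u := image.map_ι (Φ.map u) }
  refine ⟨Φ ⋙ im, e, m, fun j ↦ ?_, ?_, ?_⟩
  · have : StrongEpi (factorThruImage (φ.app j)) := inferInstance
    exact Regular.isRegularEpi_of_extremalEpi (factorThruImage (φ.app j))
  · have (j : J) : Mono (m.app j) := inferInstanceAs (Mono (image.ι (φ.app j)))
    exact NatTrans.mono_of_mono_app _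
  · ext j
    exact image.fac (φ.app j)

end FunctorCategory

/-! ### Descent along a presentation -/

section Presentation

variable {E P : Type*} [Category* E] [Category* P] (Λ : E ⥤ P) (W : MorphismProperty E)

/-- Let `Λ : E ⥤ P` preserve pullbacks, and let every morphism of `E` factor as a morphism in a
pullback-stable class `W`, which `Λ` sends to regular epimorphisms, followed by a monomorphism.
Then a regular epimorphism of `P` is stable under those base changes that come from `E`. -/
lemma isRegularEpi_of_isPullback_of_presentation [HasPullbacks E]
    [PreservesLimitsOfShape WalkingCospan Λ]
    [W.IsStableUnderBaseChange] (hW : ∀ ⦃A B : E⦄ (e : A ⟶ B), W e → IsRegularEpi (Λ.map e))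
    (fac : ∀ ⦃A B : E⦄ (φ : A ⟶ B), ∃ (I : E) (e : A ⟶ I) (m : I ⟶ B), W e ∧ Mono m ∧ e ≫ m = φ)
    {Q X Y Z : P} {f : X ⟶ Y} {g : Z ⟶ Y} {p : Q ⟶ X} {q : Q ⟶ Z} (sq : IsPullback p q f g)
    [IsRegularEpi f] {A B D : E} (φ : A ⟶ B) (γ : D ⟶ B) (a : X ≅ Λ.obj A) (b : Y ≅ Λ.obj B)
    (d : Z ≅ Λ.obj D) (hf : f ≫ b.hom = a.hom ≫ Λ.map φ) (hg : g ≫ b.hom = d.hom ≫ Λ.map γ) :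
    IsRegularEpi q := by
  obtain ⟨I, e, m, he, hm, rfl⟩ := fac φ
  have hem : a.hom ≫ Λ.map e ≫ (Λ.map m ≫ b.inv) = f := by
    rw [← cancel_mono b.hom]; simp [hf]
  -- A regular epi is extremal, and `f` factors through this mono.
  have : IsIso (Λ.map m ≫ b.inv) :=
    ExtremalEpi.isIso f (a.hom ≫ Λ.map e) (Λ.map m ≫ b.inv) (by simpa using hem)
  have : IsIso (Λ.map m) := by
    rw [show Λ.map m = (Λ.map m ≫ b.inv) ≫ b.hom by simp]; infer_instance
  obtain ⟨S, s, m', H₁⟩ : ∃ (S : E) (s : S ⟶ I) (m' : S ⟶ D), IsPullback s m' m γ :=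
    ⟨_, _, _, .of_hasPullback m γ⟩
  obtain ⟨T, t, e', H₂⟩ : ∃ (T : E) (t : T ⟶ A) (e' : T ⟶ S), IsPullback t e' e s :=
    ⟨_, _, _, .of_hasPullback e s⟩
  have : IsIso (Λ.map m') := (H₁.map Λ).isIso_snd_of_isIso
  have : IsRegularEpi (Λ.map e') := hW e' (W.of_isPullback H₂ he)
  have H : IsPullback (Λ.map t ≫ a.inv) (Λ.map (e' ≫ m') ≫ d.inv) f g :=
    ((H₂.paste_vert H₁).map Λ).of_iso (Iso.refl _) a.symm d.symm b.symm (by simp) (by simp)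
      (by simp [← hem]) (by simp [← cancel_mono b.hom, hg])
  have hq : q = (sq.isoIsPullback _ _ H).hom ≫ Λ.map e' ≫ Λ.map m' ≫ d.inv := by
    simp
  rw [hq]
  exact ((MorphismProperty.regularEpi P).cancel_left_of_respectsIso _ _).2
    (((MorphismProperty.regularEpi P).cancel_right_of_respectsIso _ _).2 this)

/-- Let `Λ : E ⥤ P` be as in `isRegularEpi_of_isPullback_of_presentation`, and assume that all
relations in `E` are difunctional. Then so are the relations of `P` given by a pair of
morphisms coming from `E`. -/
lemma isDifunctional_of_presentation [HasFiniteLimits E] [PreservesFiniteLimits Λ]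
    (hW : ∀ ⦃A B : E⦄ (e : A ⟶ B), W e → IsRegularEpi (Λ.map e))
    (fac : ∀ ⦃A B : E⦄ (φ : A ⟶ B), ∃ (I : E) (e : A ⟶ I) (m : I ⟶ B), W e ∧ Mono m ∧ e ≫ m = φ)
    (hE : ∀ ⦃R X Y : E⦄ (p₁ : R ⟶ X) (p₂ : R ⟶ Y), JointlyMono₂ p₁ p₂ → IsDifunctional p₁ p₂)
    {R X : P} {p₁ p₂ : R ⟶ X} [h : JointlyMono₂ p₁ p₂] {A B : E} (π₁ π₂ : A ⟶ B)
    (a : R ≅ Λ.obj A) (b : X ≅ Λ.obj B) (h₁ : p₁ ≫ b.hom = a.hom ≫ Λ.map π₁)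
    (h₂ : p₂ ≫ b.hom = a.hom ≫ Λ.map π₂) : IsDifunctional p₁ p₂ := by
  obtain ⟨l, hl₁, hl₂⟩ : ∃ l : A ⟶ B ⨯ B, l ≫ prod.fst = π₁ ∧ l ≫ prod.snd = π₂ :=
    ⟨prod.lift π₁ π₂, prod.lift_fst .., prod.lift_snd ..⟩
  obtain ⟨I, e, m, he, hm, rfl⟩ := fac l
  have hI : JointlyMono₂ (m ≫ prod.fst) (m ≫ (prod.snd : B ⨯ B ⟶ B)) :=
    ⟨fun T f g hf hg ↦ by
      rw [← cancel_mono m]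
      apply prod.hom_ext <;> simpa⟩
  have h₁' : p₁ ≫ b.hom = (a.hom ≫ Λ.map e) ≫ Λ.map (m ≫ prod.fst) := by
    simp [h₁, ← hl₁]
  have h₂' : p₂ ≫ b.hom = (a.hom ≫ Λ.map e) ≫ Λ.map (m ≫ prod.snd) := by
    simp [h₂, ← hl₂]
  -- The jointly monic pair factors through this map; so `Λ.map e` is both mono and regular epi.
  have : Mono (a.hom ≫ Λ.map e) := ⟨fun f g hfg ↦ h.right_cancellation _ _
    (by rw [← cancel_mono b.hom, Category.assoc, Category.assoc, h₁', ← Category.assoc, hfg, Category.assoc])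
    (by rw [← cancel_mono b.hom, Category.assoc, Category.assoc, h₂', ← Category.assoc, hfg, Category.assoc])⟩
  have := hW e he
  have : Mono (Λ.map e) := by
    rw [show Λ.map e = a.inv ≫ a.hom ≫ Λ.map e by simp]; infer_instance
  have : IsIso (Λ.map e) := isIso_of_mono_of_strongEpi _
  exact ((hE _ _ hI).map Λ).of_iso (a ≪≫ asIso (Λ.map e)) b.hom b.hom h₁' h₂'

end Presentation

/-! ### Exactness of ind- and pro-limits -/

section IndLim

variable {D : Type u} [Category.{v} D] {I : Type v} [SmallCategory I] [IsFiltered I]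

/-- `Ind.lim` sends pointwise finite limit cones to limit cones. -/
noncomputable def Ind.isLimitMapConeLim {K : Type} [SmallCategory K] [FinCategory K]
    {F : K ⥤ I ⥤ D} (c : Cone F) (hc : ∀ i, IsLimit (((evaluation I D).obj i).mapCone c)) :
    IsLimit ((Ind.lim I).mapCone c) := by
  -- Yoneda preserves the pointwise limits, and filtered colimits of presheaves commute with finite
  -- limits.
  have h₁ : IsLimit (((Functor.whiskeringRight I D _).obj yoneda).mapCone c) :=
    evaluationJointlyReflectsLimits _ fun i ↦ isLimitOfPreserves yoneda (hc i)
  have h₂ : IsLimit (((Functor.whiskeringRight I D _).obj yoneda ⋙ colim).mapCone c) :=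
    isLimitOfPreserves colim h₁
  have h₃ : IsLimit ((Ind.inclusion D).mapCone ((Ind.lim I).mapCone c)) :=
    IsLimit.mapConeEquiv Ind.limCompInclusion.symm h₂
  exact isLimitOfReflects (Ind.inclusion D) h₃

/-- `Ind.lim` sends pointwise equalizers to equalizers. -/
noncomputable def Ind.isLimitForkLim {F G H : I ⥤ D} {α : F ⟶ G} {β γ : G ⟶ H}
    (w : α ≫ β = α ≫ γ) (h : ∀ i, IsLimit (Fork.ofι (α.app i) congr(($w).app i))) :
    IsLimit (Fork.ofι ((Ind.lim I).map α)
      (show _ ≫ (Ind.lim I).map β = _ ≫ (Ind.lim I).map γ by simp only [← Functor.map_comp, w])) :=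
  isLimitMapConeForkEquiv _ _ (Ind.isLimitMapConeLim _ fun i ↦
    (isLimitMapConeForkEquiv ((evaluation I D).obj i) w).symm (h i))

end IndLim

section ProLim

variable (C : Type u) [SmallCategory C] [HasFiniteLimits C]

/-- The category of left exact functors on `C` is equivalent to the category of ind-objects
of `Cᵒᵖ`. -/
noncomputable def indOpEquivalence : Ind Cᵒᵖ ≌ (C ⥤ₗ Type u) :=
  (Ind.leftExactFunctorEquivalence Cᵒᵖ).trans
    ((opOpEquivalence C).congrLeft.congrFullSubcategory (by
      ext F
      refine ⟨fun h ↦ ?_, fun h ↦ ?_⟩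
      · have : PreservesFiniteLimits ((opOpEquivalence C).inverse ⋙ F) := h
        have : PreservesFiniteLimits ((opOpEquivalence C).functor ⋙
          (opOpEquivalence C).inverse ⋙ F) := comp_preservesFiniteLimits _ _
        exact preservesFiniteLimits_of_natIso ((opOpEquivalence C).funInvIdAssoc F)
      · have : PreservesFiniteLimits F := h
        exact comp_preservesFiniteLimits (opOpEquivalence C).inverse F))

variable (I : Type u) [SmallCategory I] [IsFiltered I]

/-- The functor sending a small cofiltered diagram in `C` to the corresponding pro-object,
considered as an object of the opposite of the category of left exact functors. -/
noncomputable def proLim : (Iᵒᵖ ⥤ C) ⥤ (C ⥤ₗ Type u)ᵒᵖ :=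
  ((Functor.leftOpRightOpEquiv I C).functor ⋙ Ind.lim I ⋙ (indOpEquivalence C).functor).rightOp

instance : PreservesFiniteLimits (proLim C I) := by
  have : PreservesFiniteColimits (Ind.lim I : (I ⥤ Cᵒᵖ) ⥤ _) := ⟨fun _ _ _ ↦ inferInstance⟩
  have := comp_preservesFiniteColimits (Ind.lim I : (I ⥤ Cᵒᵖ) ⥤ _) (indOpEquivalence C).functor
  have := comp_preservesFiniteColimits (Functor.leftOpRightOpEquiv I C).functor
    (Ind.lim I ⋙ (indOpEquivalence C).functor)
  exact preservesFiniteLimits_rightOp _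

variable {C I}

/-- Each component is the coequaliser of its kernel pair, and kernel pairs are pointwise. Dually
this is a pointwise equaliser, which `Ind.lim` preserves. -/
lemma isRegularEpi_proLim_map {A B : Iᵒᵖ ⥤ C} (e : A ⟶ B) (he : pointwiseRegularEpi _ _ e) :
    IsRegularEpi ((proLim C I).map e) := by
  obtain ⟨K, a, b, hK⟩ : ∃ (K : Iᵒᵖ ⥤ C) (a b : K ⟶ A), IsKernelPair e a b :=
    ⟨_, _, _, .of_hasPullback e⟩
  have w : NatTrans.rightOp e ≫ NatTrans.rightOp a = NatTrans.rightOp e ≫ NatTrans.rightOp b := by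
    ext i
    exact congr(($(hK.w).app (op i)).op)
  have h (i : I) : IsLimit (Fork.ofι ((NatTrans.rightOp e).app i) congr(($w).app i)) :=
    have : IsRegularEpi (((evaluation Iᵒᵖ C).obj (op i)).map e) := he (op i)
    Cofork.isColimitOfπEquivIsLimitOp _ _ _ _ rfl
      (IsKernelPair.toCoequalizer' (hK.map ((evaluation Iᵒᵖ C).obj (op i))))
  have := isLimitForkMapOfIsLimit (indOpEquivalence C).functor _ (Ind.isLimitForkLim w h)
  have : IsRegularMono ((indOpEquivalence C).functor.map ((Ind.lim I).map (NatTrans.rightOp e))) :=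
    ⟨⟨{ Z := _, left := _, right := _, w := _, isLimit := this}⟩⟩
  exact inferInstanceAs (IsRegularEpi
    ((indOpEquivalence C).functor.map ((Ind.lim I).map (NatTrans.rightOp e))).op)

end ProLim

/-! ### Lifting morphisms to diagrams -/

section IndPresentation

variable {D : Type u} [Category.{v} D]

/-- Any parallel pair of ind-objects comes from a parallel pair of filtered diagrams. -/
lemma Ind.exists_parallelPair_presentation {A B : Ind D} (f g : A ⟶ B) :
    ∃ (I : Type v) (_ : SmallCategory I) (_ : IsFiltered I) (F G : I ⥤ D) (φ ψ : F ⟶ G)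
      (a : A ≅ (Ind.lim I).obj F) (b : B ≅ (Ind.lim I).obj G),
      f ≫ b.hom = a.hom ≫ (Ind.lim I).map φ ∧ g ≫ b.hom = a.hom ≫ (Ind.lim I).map ψ := by
  obtain ⟨P⟩ := nonempty_indParallelPairPresentation A.isIndObject_inclusion_obj
    B.isIndObject_inclusion_obj
    (Ind.inclusion _ |>.map f) (Ind.inclusion _ |>.map g)
  let τ := P.parallelPairIsoParallelPairCompIndYoneda
  exact ⟨P.I, inferInstance, inferInstance, P.F₁, P.F₂, P.φ, P.ψ, τ.app .zero, τ.app .one,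
    τ.hom.naturality WalkingParallelPairHom.left, τ.hom.naturality WalkingParallelPairHom.right⟩

/-- The isomorphism between an ind-object and the ind-limit of a diagram presenting it. -/
noncomputable def Ind.isoLimOfIsColimit {A : Ind D} {I : Type v} [SmallCategory I] [IsFiltered I]
    {F : I ⥤ D} {c : F ⋙ yoneda ⟶ (Functor.const I).obj ((Ind.inclusion D).obj A)}
    (hc : IsColimit (Cocone.mk _ c)) : A ≅ (Ind.lim I).obj F :=
  (Ind.inclusion D).preimageIso
    (hc.coconePointUniqueUpToIso (colimit.isColimit _) ≪≫ (Ind.limCompInclusion.app F).symm)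

lemma Ind.isoLimOfIsColimit_naturality {A B : Ind D} {I : Type v} [SmallCategory I] [IsFiltered I]
    {F G : I ⥤ D} {c : F ⋙ yoneda ⟶ (Functor.const I).obj ((Ind.inclusion D).obj A)}
    (hc : IsColimit (Cocone.mk _ c))
    {d : G ⋙ yoneda ⟶ (Functor.const I).obj ((Ind.inclusion D).obj B)}
    (hd : IsColimit (Cocone.mk _ d)) (f : A ⟶ B) (φ : F ⟶ G)
    (h : ∀ i, c.app i ≫ (Ind.inclusion D).map f = yoneda.map (φ.app i) ≫ d.app i) :
    f ≫ (Ind.isoLimOfIsColimit hd).hom = (Ind.isoLimOfIsColimit hc).hom ≫ (Ind.lim I).map φ := by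
  apply (Ind.inclusion D).map_injective
  have hφ := Ind.limCompInclusion.inv.naturality φ
  simp only [Functor.comp_map] at hφ
  simp only [Ind.isoLimOfIsColimit, Functor.map_comp, Functor.preimageIso_hom,
    Functor.map_preimage, Iso.trans_hom, Iso.symm_hom, Iso.app_inv, Category.assoc, ← hφ]
  simp only [← Category.assoc]
  congr 1
  refine hc.hom_ext fun i ↦ ?_
  have hc' := hc.comp_coconePointUniqueUpToIso_hom (colimit.isColimit _) i
  have hd' := hd.comp_coconePointUniqueUpToIso_hom (colimit.isColimit _) i
  dsimp at hc' hd' ⊢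
  rw [reassoc_of% h, hd', reassoc_of% hc']
  exact (ι_colimMap (Functor.whiskerRight φ yoneda) i).symm

/-- Any span of ind-objects comes from a span of filtered diagrams. -/
lemma Ind.exists_span_presentation {A B B' : Ind D} (f : A ⟶ B) (g : A ⟶ B') :
    ∃ (I : Type v) (_ : SmallCategory I) (_ : IsFiltered I) (F G G' : I ⥤ D) (φ : F ⟶ G)
      (ψ : F ⟶ G') (a : A ≅ (Ind.lim I).obj F) (b : B ≅ (Ind.lim I).obj G)
      (b' : B' ≅ (Ind.lim I).obj G'),
      f ≫ b.hom = a.hom ≫ (Ind.lim I).map φ ∧ g ≫ b'.hom = a.hom ≫ (Ind.lim I).map ψ := by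
  -- Only `f` is to be presented, so it is paired with itself.
  obtain ⟨P⟩ := nonempty_indParallelPairPresentation A.isIndObject_inclusion_obj
    B.isIndObject_inclusion_obj
    (Ind.inclusion _ |>.map f) (Ind.inclusion _ |>.map f)
  let Q : IndObjectPresentation ((Ind.inclusion D).obj A) :=
    { I := P.I, F := P.F₁, ι := P.ι₁, isColimit := P.isColimit₁ }
  let Q' := B'.presentation
  let L : P.I ⥤ CostructuredArrow yoneda ((Ind.inclusion D).obj B') :=
    Q.toCostructuredArrow ⋙ CostructuredArrow.map ((Ind.inclusion D).map g)
  -- An object of `K` is a lift of `g` from a stage of `A` to a stage of `B'`. As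
  -- `Q'.toCostructuredArrow` is final, `K` is filtered with both projections final, so reindexing
  -- along them keeps the colimits.
  let K := Comma L Q'.toCostructuredArrow
  have : IsFiltered K := Comma.isFiltered_of_final _ _
  let p : K ⥤ P.I := Comma.fst _ _
  let q : K ⥤ Q'.I := Comma.snd _ _
  have hA : IsColimit (Cocone.mk _ (p.whiskerLeft P.ι₁)) :=
    (Functor.Final.isColimitWhiskerEquiv p _).symm P.isColimit₁
  have hB : IsColimit (Cocone.mk _ (p.whiskerLeft P.ι₂)) :=
    (Functor.Final.isColimitWhiskerEquiv p _).symm P.isColimit₂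
  have hB' : IsColimit (Cocone.mk _ (q.whiskerLeft Q'.ι)) :=
    (Functor.Final.isColimitWhiskerEquiv q _).symm Q'.isColimit
  let ψ : p ⋙ P.F₁ ⟶ q ⋙ Q'.F :=
    { app k := k.hom.left
      naturality _ _ u := congr(($u.w).left) }
  refine ⟨K, inferInstance, inferInstance, p ⋙ P.F₁, p ⋙ P.F₂, q ⋙ Q'.F,
    p.whiskerLeft P.φ, ψ, Ind.isoLimOfIsColimit hA, Ind.isoLimOfIsColimit hB,
    Ind.isoLimOfIsColimit hB', Ind.isoLimOfIsColimit_naturality _ _ _ _ fun k ↦ ?_,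
    Ind.isoLimOfIsColimit_naturality _ _ _ _ fun k ↦ ?_⟩
  · exact congr(P.ι₁.app (p.obj k) ≫ $(P.hf)).trans (P.isColimit₁.ι_map _ _ _)
  · exact (CostructuredArrow.w k.hom).symm

end IndPresentation

section ProPresentation

variable {C : Type u} [SmallCategory C] [HasFiniteLimits C] {I : Type u} [SmallCategory I]
  [IsFiltered I]

/-- The isomorphism in the opposite of the category of left exact functors that is induced by a
presentation of the corresponding ind-object. -/
noncomputable def isoProLim {X : (C ⥤ₗ Type u)ᵒᵖ} {F : I ⥤ Cᵒᵖ}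
    (a : (indOpEquivalence C).inverse.obj X.unop ≅ (Ind.lim I).obj F) :
    X ≅ (proLim C I).obj F.leftOp :=
  ((((indOpEquivalence C).counitIso.app X.unop).symm ≪≫
    (indOpEquivalence C).functor.mapIso a).op.symm :)

lemma isoProLim_naturality {X Y : (C ⥤ₗ Type u)ᵒᵖ} {F G : I ⥤ Cᵒᵖ} (f : X ⟶ Y) (φ : F ⟶ G)
    (a : (indOpEquivalence C).inverse.obj Y.unop ≅ (Ind.lim I).obj F)
    (b : (indOpEquivalence C).inverse.obj X.unop ≅ (Ind.lim I).obj G)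
    (h : (indOpEquivalence C).inverse.map f.unop ≫ b.hom = a.hom ≫ (Ind.lim I).map φ) :
    f ≫ (isoProLim a).hom = (isoProLim b).hom ≫ (proLim C I).map (NatTrans.leftOp φ) := by
  apply Quiver.Hom.unop_inj
  have h' : a.inv ≫ (indOpEquivalence C).inverse.map f.unop = (Ind.lim I).map φ ≫ b.inv := by
    rw [Iso.inv_comp_eq, ← Category.assoc, ← h]; simp
  have h'' := congr((indOpEquivalence C).functor.map $h')
  simp only [Functor.map_comp] at h''
  change ((indOpEquivalence C).functor.map a.inv ≫ (indOpEquivalence C).counit.app _) ≫ f.unop =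
    (indOpEquivalence C).functor.map ((Ind.lim I).map φ) ≫ (indOpEquivalence C).functor.map b.inv ≫
      (indOpEquivalence C).counit.app _
  rw [← reassoc_of% h'']
  simp

end ProPresentation

section

variable {C D J : Type*} [Category* C] [Category* D] [Category* J] [HasLimitsOfShape J D]

/-- Left exact functors are closed under limits. -/
instance : (leftExactFunctor C D).IsClosedUnderLimitsOfShape J := .mk' (by
  rintro _ ⟨F, hF⟩
  refine ⟨fun K _ _ ↦ ?_⟩
  have : PreservesLimitsOfShape K F.flip := preservesLimitsOfShape_of_evaluation _ _ fun j ↦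
    have : PreservesFiniteLimits (F.obj j) := hF j
    inferInstanceAs (PreservesLimitsOfShape K (F.obj j))
  exact preservesLimitsOfShape_of_natIso (limitIsoFlipCompLim F).symm)

end

end CategoryTheory

theorem mainTheorem5 (C : Type u) [SmallCategory.{u} C] [Regular C] [IsMaltsevCategory C] :
    Regular (C ⥤ₗ Type u)ᵒᵖ ∧ IsMaltsevCategory (C ⥤ₗ Type u)ᵒᵖ := by
  have : HasColimits (C ⥤ₗ Type u) :=
    Adjunction.has_colimits_of_equivalence (indOpEquivalence C).inverse
  -- These become the coequalisers of the opposite category.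
  have : HasEqualizers (C ⥤ₗ Type u) :=
    hasLimitsOfShape_of_closedUnderLimits _ _
  have : HasFiniteLimits (C ⥤ₗ Type u)ᵒᵖ := hasFiniteLimits_opposite
  refine ⟨{
    hasCoequalizer_of_isKernelPair _ := inferInstance
    regularEpiIsStableUnderBaseChange := ⟨fun {X Y Z Q f g p q} sq hf ↦ ?_⟩ },
    { isEquivalenceRelation := fun {R X} p₁ p₂ hp ↦ ?_ }⟩
  · have hf : IsRegularEpi g := hf
    obtain ⟨I, _, _, F, G, G', φ, ψ, a, b, b', h₁, h₂⟩ := Ind.exists_span_presentation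
      ((indOpEquivalence C).inverse.map g.unop) ((indOpEquivalence C).inverse.map f.unop)
    exact isRegularEpi_of_isPullback_of_presentation (proLim C I) (pointwiseRegularEpi _ _)
      (fun _ _ ↦ isRegularEpi_proLim_map) (fun _ _ ↦ exists_pointwiseRegularEpi_mono_fac)
      sq _ _ (isoProLim b) (isoProLim a) (isoProLim b') (isoProLim_naturality g φ a b h₁)
      (isoProLim_naturality f ψ a b' h₂)
  · have := hp.toJointlyMono₂
    obtain ⟨I, _, _, F, G, φ, ψ, a, b, h₁, h₂⟩ := Ind.exists_parallelPair_presentation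
      ((indOpEquivalence C).inverse.map p₁.unop) ((indOpEquivalence C).inverse.map p₂.unop)
    exact (isDifunctional_of_presentation (proLim C I) (pointwiseRegularEpi _ _)
      (fun _ _ ↦ isRegularEpi_proLim_map) (fun _ _ ↦ exists_pointwiseRegularEpi_mono_fac)
      (fun _ _ _ p₁ p₂ _ ↦ JointlyMono₂.isDifunctional_functor p₁ p₂) _ _ (isoProLim b)
      (isoProLim a) (isoProLim_naturality p₁ φ a b h₁)
      (isoProLim_naturality p₂ ψ a b h₂)).isEquivalenceRelation hp
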